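/- Let $n \geq 4$ and let $\Omega$ be the set of all nonzero polynomials in $\mathbb{F}_2[x]$ of degree less than $n$. Let $\Gamma_n$ be the digraph with vertex set $\Omega$ in which there is an arc from $a(x)$ to $b(x)$ if and only if \[ b(x) = x\,a(x) \bmod x^n \quad\text{(label } 0) \qquad\text{or}\qquad b(x) = \bigl(x\,a(x) \bmod x^n\bigr) + \sum_{i=0}^{n-1} x^i \quad\text{(label } 1). \] A Hamiltonian cycle in $\Gamma_n$ is a directed cycle that visits every vertex exactly once; two Hamiltonian cycles are the same if they differ only in the choice of the starting vertex. To a Hamiltonian cycle $\mathcal{H}$ corresponds the infinite periodic binary sequence of the labels of the arcs traversed when going around $\mathcal{H}$ repeatedly from some starting vertex (it is determined by $\mathcal{H}$ up to cyclic shift). A binary de Bruijn sequence of order $n$ is an infinite binary sequence with least period $2^n$ in which each binary $n$-tuple appears exactly once per period. A modified de Bruijn sequence of order $n$ is a sequence obtained from a binary de Bruijn sequence of order $n$ by removing, in each period, a zero from the longest run of zeros (the starting point of the resulting sequence may be chosen freely). Two sequences are inequivalent if neither is a cyclic shift of the other. Then the following hold. 1. Every sequence corresponding to a Hamiltonian cycle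 in $\Gamma_n$ is a modified de Bruijn sequence of order $n$, and distinct Hamiltonian cycles in $\Gamma_n$ correspond to inequivalent modified de Bruijn sequences. 2. The number of distinct Hamiltonian cycles in $\Gamma_n$ is $2^{2^{n-1}-n}$. -/

import Mathlib

open Polynomial

/-- The set `Ω` of all nonzero binary polynomials of degree less than `n`. -/
def Omega (n : ℕ) : Set (ZMod 2)[X] := {a | a ≠ 0 ∧ a.degree < n}

/-- The end of the doubling arc leaving `a`: the polynomial `x a(x) mod x ^ n`. -/
noncomputable def double (n : ℕ) (a : (ZMod 2)[X]) : (ZMod 2)[X] :=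
  (X * a) %ₘ (X ^ n)

/-- The end of the complement arc leaving `a`: the polynomial
`(x a(x) mod x ^ n) + (1 + x + ⋯ + x ^ (n - 1))`. -/
noncomputable def doubleComplement (n : ℕ) (a : (ZMod 2)[X]) : (ZMod 2)[X] :=
  (X * a) %ₘ (X ^ n) + ∑ i ∈ Finset.range n, X ^ i

/-- The digraph `Γ_n` on the vertex set `Ω`. -/
def Gamma (n : ℕ) : Digraph (Omega n) where
  Adj a b := (b : (ZMod 2)[X]) = double n a ∨ (b : (ZMod 2)[X]) = doubleComplement n a

open Classical in
/-- The label of the arc from `a` to `b` of `Γ_n`: `0` on doubling arcs, `1` on complement arcs. -/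
noncomputable def arcLabel (n : ℕ) (a b : Omega n) : ZMod 2 :=
  if (b : (ZMod 2)[X]) = double n a then 0 else 1

/-- `c`, a list of vertices up to rotation, is a Hamiltonian cycle of the digraph `G`: it visits
every vertex exactly once and follows arcs of `G`, including the arc from its last vertex back to
its first. -/
def IsHamiltonianCycle {V : Type*} (G : Digraph V) (c : Cycle V) : Prop :=
  c.Nodup ∧ (∀ v, v ∈ c) ∧ c.Chain G.Adj

/-- `N` is the least period of the infinite sequence `s`. -/
def HasPeriod (s : ℕ → ZMod 2) (N : ℕ) : Prop :=
  IsLeast {M : ℕ | 0 < M ∧ ∀ i, s (i + M) = s i} N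

/-- Cyclic equivalence of sequences: `a` is a shift of `b`. -/
def CyclicallyEquivalent (a b : ℕ → ZMod 2) : Prop :=
  ∃ k : ℕ, ∀ i, a i = b (i + k)

/-- `d` is a binary de Bruijn sequence of order `n`: its period is `2 ^ n` and each binary
`n`-tuple appears exactly once per period. -/
def IsDeBruijn (n : ℕ) (d : ℕ → ZMod 2) : Prop :=
  HasPeriod d (2 ^ n) ∧
    ∀ w : Fin n → ZMod 2, ∃! i : ℕ, i < 2 ^ n ∧ ∀ j : Fin n, d (i + j) = w j

/-- The `L` consecutive terms of `d` from position `a` on are all zero. -/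
def IsZeroRun (d : ℕ → ZMod 2) (a L : ℕ) : Prop :=
  ∀ j < L, d (a + j) = 0

/-- Position `p` of `d` lies in a longest run of zeros of `d`. -/
def InLongestZeroRun (d : ℕ → ZMod 2) (p : ℕ) : Prop :=
  ∃ a L : ℕ, IsZeroRun d a L ∧ (∀ a' L' : ℕ, IsZeroRun d a' L' → L' ≤ L) ∧ a ≤ p ∧ p < a + L

/-- `s` is a modified de Bruijn sequence of order `n`: in some de Bruijn sequence `d` of order `n`,
one zero of the longest run of zeros, at position `p`, is removed from each period. What is left of
a period is the word `d (p + 1), …, d (p + 2 ^ n - 1)`; `s` repeats this word periodically,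
starting at any place in it. -/
def IsModifiedDeBruijn (n : ℕ) (s : ℕ → ZMod 2) : Prop :=
  ∃ d : ℕ → ZMod 2, IsDeBruijn n d ∧ ∃ p : ℕ, InLongestZeroRun d p ∧
    ∃ k : ℕ, ∀ i, s i = d (p + 1 + (i + k) % (2 ^ n - 1))

/-- `s` is a sequence corresponding to the cycle `H` of `Γ_n`: the sequence of the labels of the
arcs that are traversed when going around `H` forever, from some starting vertex on. -/
def CorrespondsTo {n : ℕ} (H : Cycle (Omega n)) (s : ℕ → ZMod 2) : Prop :=
  ∃ v : ℕ → Omega n,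
    H = (((List.range H.length).map v : List (Omega n)) : Cycle (Omega n)) ∧
    (∀ i, v (i + H.length) = v i) ∧
    ∀ i, s i = arcLabel n (v i) (v (i + 1))

/-!
Reading off, for each vertex of `Γ_n`, the labels of the last `n` arcs of a walk that ends there
identifies the vertices with the nonzero binary words of length `n` and the arcs with those of the
de Bruijn graph: a word is shifted and a letter is appended (`vertexWord`, `Gamma_adj_iff`). A
Hamiltonian cycle of `Γ_n` must pass from `10…0` to `0…01`, and the zero word can be inserted
between the two. This turns it into a closed walk through all `2 ^ n` words
(`insertZero_mem_deBruijnWalks`), whose last letters form a de Bruijn sequence. The inserted step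
contributes one zero of the longest run, so the labels of the cycle form a modified de Bruijn
sequence. Conversely the labels determine the words, hence the vertices, hence the cycle
(`ListsHamiltonianCycle.eq_add_of_arcLabel_eq`).

It remains to count the closed walks through all words of length `n = m + 1`, that is, the functions
`g` of `m` bits for which the permutation `σ_g : u ↦ (u₁, …, u_m, u₀ + g (u₁, …, u_m))` is a single
cycle. For a permutation `σ` of a set `V` with matrix `M_σ`, the determinant of
`I - M_σ + 1 ⊗ e_r` is `|V|` if `σ` is a single cycle (`det_rootedLaplacian_eq_card`), and `0` if it
is not (`det_rootedLaplacian_eq_zero`). The determinants for all `g` can be summed: the value of `g`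
at `w` only affects the two rows of the words with tail `w`, by exchanging the subtracted unit
vectors `c` and `d`, and the exterior identity
`(a - c) ∧ (b - d) + (a - d) ∧ (b - c) = 2 (a - s) ∧ (b - s)` with `s = (c + d) / 2` replaces both
choices by their average (`det_updateRow_pair_add`). Hence the sum is `2 ^ 2 ^ m` times the
determinant of `I - P + 1 ⊗ e_r`, where `P` is the transition matrix of the random walk on the
de Bruijn graph. This walk forgets its starting point after `n` steps, so `P - 1 ⊗ e_r` is nilpotent
(`isNilpotent_shiftWalk`) and the last determinant is `1`. The number of cyclic `σ_g` is therefore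
`2 ^ 2 ^ m / 2 ^ n`.
-/

/-! ### Determinants attached to permutations -/

/-- The sum over the two ways to pair the subtracted vectors `c`, `d` with two given rows. The
reason is the exterior identity
`(a - c) ∧ (b - d) + (a - d) ∧ (b - c) = 2 (a - s) ∧ (b - s)` with `s = (c + d) / 2`. -/
theorem det_updateRow_pair_add {V : Type*} [Fintype V] [DecidableEq V] (M : Matrix V V ℚ)
    {i j : V} (hij : i ≠ j) (a b c d : V → ℚ) :
    ((M.updateRow i (a - c)).updateRow j (b - d)).det +
      ((M.updateRow i (a - d)).updateRow j (b - c)).det =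
    2 * ((M.updateRow i (a - (1 / 2 : ℚ) • (c + d))).updateRow j
      (b - (1 / 2 : ℚ) • (c + d))).det := by
  set F : (V → ℚ) → (V → ℚ) → ℚ := fun p q => ((M.updateRow i p).updateRow j q).det with hF
  have addr : ∀ p q q', F p (q + q') = F p q + F p q' := fun p q q' =>
    Matrix.det_updateRow_add _ _ _ _
  have smulr : ∀ p (t : ℚ) q, F p (t • q) = t * F p q := fun p t q =>
    Matrix.det_updateRow_smul _ _ _ _
  have addl : ∀ p p' q, F (p + p') q = F p q + F p' q := fun p p' q => by
    simp only [hF, Matrix.updateRow_comm _ hij]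
    exact Matrix.det_updateRow_add _ _ _ _
  have smull : ∀ (t : ℚ) p q, F (t • p) q = t * F p q := fun t p q => by
    simp only [hF, Matrix.updateRow_comm _ hij]
    exact Matrix.det_updateRow_smul _ _ _ _
  have alt : ∀ p, F p p = 0 := fun p => by
    refine Matrix.det_zero_of_row_eq hij ?_
    rw [Matrix.updateRow_ne hij, Matrix.updateRow_self, Matrix.updateRow_self]
  have swap : F c d + F d c = 0 := by
    have h := alt (c + d)
    simpa [addl, addr, alt] using h
  have neg : ∀ p : V → ℚ, -p = (-1 : ℚ) • p := fun p => by simp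
  change F _ _ + F _ _ = 2 * F _ _
  simp only [sub_eq_add_neg, neg, addl, addr, smull, smulr, alt, smul_add]
  linear_combination (1 / 2 : ℚ) * swap

/-- If replacing the value of `x` at any one place by either of two alternatives gives, in sum,
twice the value of `Ψ` at an averaged replacement, then the sum of `Ψ` over all choices of
alternatives is `2 ^ |W|` times the value of `Ψ` at the average. -/
theorem sum_choices_eq_of_average {W X : Type*} [Fintype W] [DecidableEq W] (Ψ : (W → X) → ℚ)
    (r : W → ZMod 2 → X) (m : W → X)
    (h : ∀ x w, Ψ (Function.update x w (r w 0)) + Ψ (Function.update x w (r w 1)) =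
      2 * Ψ (Function.update x w (m w))) :
    ∑ g : W → ZMod 2, Ψ (fun w => r w (g w)) = 2 ^ Fintype.card W * Ψ m := by
  classical
  have key : ∀ S : Finset W,
      ∑ g : W → ZMod 2, Ψ (fun w => if w ∈ S then m w else r w (g w)) =
        ∑ g : W → ZMod 2, Ψ (fun w => r w (g w)) := by
    intro S
    induction S using Finset.induction_on with
    | empty => simp
    | insert w S hw ih =>
      rw [← ih]
      -- Flipping the choice at `w` is a bijection of the index set, so the sum may be symmetrized.
      let e : (W → ZMod 2) ≃ (W → ZMod 2) := Equiv.addRight (Pi.single w 1)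
      have h2 := Equiv.sum_comp e
        (fun g : W → ZMod 2 => Ψ (fun w => if w ∈ S then m w else r w (g w)))
      have h3 : ∀ g : W → ZMod 2,
          Ψ (fun v => if v ∈ S then m v else r v (g v)) +
            Ψ (fun v => if v ∈ S then m v else r v (e g v)) =
          2 * Ψ (fun v => if v ∈ insert w S then m v else r v (g v)) := by
        intro g
        set x : W → X := fun v => if v ∈ S then m v else r v (g v) with hx
        have e1 : x = Function.update x w (r w (g w)) := by
          refine (Function.update_eq_self_iff.2 ?_).symm
          simp [hx, hw]
        have e2 : (fun v => if v ∈ S then m v else r v (e g v)) =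
            Function.update x w (r w (g w + 1)) := by
          funext v
          by_cases hv : v = w
          · subst hv; simp [hw, e]
          · simp [hv, hx, e]
        have e3 : (fun v => if v ∈ insert w S then m v else r v (g v)) =
            Function.update x w (m w) := by
          funext v
          by_cases hv : v = w
          · subst hv; simp
          · simp [hv, hx]
        rw [e2, e3, ← h x w]
        conv_lhs => rw [e1]
        rw [Function.update_idem]
        generalize g w = c
        fin_cases c
        · rfl
        · exact add_comm _ _
      have h4 := Finset.sum_congr rfl (fun g (_ : g ∈ Finset.univ) => h3 g)
      rw [Finset.sum_add_distrib, h2, ← Finset.mul_sum] at h4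
      linarith
  have := key Finset.univ
  rw [← this]
  simp

/-- The matrix `I - M + 1 ⊗ e_r`, where `M` is the matrix of the map `f` and `e_r` is the
indicator of the point `r`. -/
def rootedLaplacian {V : Type*} [DecidableEq V] (f : V → V) (r : V) : Matrix V V ℚ :=
  Matrix.of fun u => Pi.single u 1 + Pi.single r 1 - Pi.single (f u) 1

theorem det_rootedLaplacian_eq_zero {V : Type*} [Fintype V] [DecidableEq V]
    (σ : Equiv.Perm V) (r : V) (h : ¬ σ.IsCycleOn Set.univ) :
    (rootedLaplacian σ r).det = 0 := by
  classical
  -- The indicator of the complement of the orbit of `r` is in the kernel.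
  refine Matrix.exists_mulVec_eq_zero_iff.1 ⟨fun v => if σ.SameCycle r v then 0 else 1, ?_, ?_⟩
  · intro h0
    refine h ⟨σ.bijective.bijOn_univ, fun x _ y _ => ?_⟩
    have hs : ∀ v, σ.SameCycle r v := fun v => by
      by_contra hv
      simpa [hv] using congrFun h0 v
    exact (hs x).symm.trans (hs y)
  · funext u
    change (Pi.single u (1 : ℚ) + Pi.single r 1 - Pi.single (σ u) 1 : V → ℚ) ⬝ᵥ _ = 0
    rw [sub_dotProduct, add_dotProduct]
    simp [Equiv.Perm.SameCycle.refl]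

/-- In the order `r, σ r, σ² r, …` the matrix is a unitriangular matrix times a triangular matrix
with diagonal `|V|, 1, …, 1`. -/
theorem det_rootedLaplacian_eq_card {V : Type*} [Fintype V] [DecidableEq V]
    (σ : Equiv.Perm V) (r : V) (h : σ.IsCycleOn Set.univ) :
    (rootedLaplacian σ r).det = Fintype.card V := by
  classical
  obtain ⟨K, hK⟩ : ∃ K, Fintype.card V = K + 1 :=
    Nat.exists_eq_succ_of_ne_zero (Fintype.card_pos_iff.2 ⟨r⟩).ne'
  have hc : σ.IsCycleOn ((Finset.univ : Finset V) : Set V) := by simpa using h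
  have hlast : (σ ^ (K + 1)) r = r := by
    rw [← hK]; exact hc.pow_card_apply (Finset.mem_univ r)
  have hsurj : Function.Surjective (fun i : Fin (K + 1) => (σ ^ (i : ℕ)) r) := by
    intro v
    obtain ⟨t, ht, hv⟩ := hc.exists_pow_eq (Finset.mem_univ r) (Finset.mem_univ v)
    rw [Finset.card_univ, hK] at ht
    exact ⟨⟨t, ht⟩, hv⟩
  let e : Fin (K + 1) ≃ V := Equiv.ofBijective _
    ((Fintype.bijective_iff_surjective_and_card _).2 ⟨hsurj, by simp [hK]⟩)
  have he : ∀ i, e i = (σ ^ (i : ℕ)) r := fun _ => rfl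
  have he0 : e 0 = r := by simp [he]
  have hstep : ∀ i : Fin K, σ (e i.castSucc) = e i.succ := fun i => by
    simp [he, pow_succ']
  have hwrap : σ (e (Fin.last K)) = r := by
    rw [he, ← Equiv.Perm.mul_apply, Fin.val_last, ← pow_succ', hlast]
  let A : Matrix (Fin (K + 1)) (Fin (K + 1)) ℚ :=
    Matrix.of fun i j => (if i = j then 1 else 0) - if (i : ℕ) + 1 = j then 1 else 0
  let B : Matrix (Fin (K + 1)) (Fin (K + 1)) ℚ :=
    Matrix.of fun i j => (if i = j then 1 else 0) + if j = 0 then (K : ℚ) - (i : ℕ) else 0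
  have hA : A.det = 1 := by
    rw [Matrix.det_of_isUpperTriangular]
    · simp [A]
    · intro i j hij
      have hij : j < i := hij
      have h1 : i ≠ j := hij.ne'
      have h2 : (i : ℕ) + 1 ≠ j := by have := Fin.lt_def.1 hij; omega
      simp [A, h1, h2]
  have hB : B.det = K + 1 := by
    rw [Matrix.det_of_isLowerTriangular]
    · rw [Fin.prod_univ_succ]
      simp [B, add_comm]
    · intro i j hij
      have hij : i < j := hij
      have h2 : j ≠ 0 := by rintro rfl; exact absurd hij (Fin.not_lt_zero i)
      simp [B, hij.ne, h2]
  have hAB : (rootedLaplacian σ r).submatrix e e = A * B := by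
    ext i j
    rw [Matrix.mul_apply]
    have hs : ∀ x y : Fin (K + 1), (Pi.single (e x) (1 : ℚ) : V → ℚ) (e y) =
        if x = y then 1 else 0 := fun x y => by
      simp [Pi.single_apply, eq_comm]
    induction i using Fin.lastCases with
    | last =>
      have : ∀ x, A (Fin.last K) x = if Fin.last K = x then 1 else 0 := fun x => by
        have : K + 1 ≠ (x : ℕ) := by omega
        simp [A, this]
      simp only [this, ite_mul, one_mul, zero_mul, Finset.sum_ite_eq, Finset.mem_univ, if_true]
      simp only [rootedLaplacian, Matrix.submatrix_apply, Matrix.of_apply, Pi.add_apply,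
        Pi.sub_apply, hwrap, hs, B]
      simp
    | cast i =>
      have : ∀ x, A i.castSucc x =
          (if i.castSucc = x then 1 else 0) - if i.succ = x then 1 else 0 := fun x => by
        simp [A, Fin.ext_iff]
      simp only [this, sub_mul, ite_mul, one_mul, zero_mul, Finset.sum_sub_distrib,
        Finset.sum_ite_eq, Finset.mem_univ, if_true]
      simp only [rootedLaplacian, Matrix.submatrix_apply, Matrix.of_apply, Pi.add_apply,
        Pi.sub_apply, hstep, hs, B]
      rw [← he0, hs]
      by_cases hj : j = 0
      · subst hj; simp; ring
      · simp [hj, Ne.symm hj]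
  rw [← Matrix.det_submatrix_equiv_self e, hAB, Matrix.det_mul, hA, hB, hK]
  simp

theorem det_one_sub_of_isNilpotent {V : Type*} [Fintype V] [DecidableEq V] (B : Matrix V V ℚ)
    (hB : IsNilpotent B) : (1 - B).det = 1 := by
  have h := (Matrix.isNilpotent_charpoly_sub_pow_of_isNilpotent hB).eq_zero
  have h2 := Matrix.eval_charpoly B 1
  rw [sub_eq_zero.1 h] at h2
  simpa using h2.symm

/-! ### Shift permutations of binary words -/

/-- The permutation `u ↦ (u₁, …, u_m, u₀ + g (u₁, …, u_m))` of the binary words of length `m + 1`: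
the nonsingular feedback shift register with feedback function `u₀ + g`. -/
def shiftPerm {m : ℕ} (g : (Fin m → ZMod 2) → ZMod 2) : Equiv.Perm (Fin (m + 1) → ZMod 2) where
  toFun u := Fin.snoc (Fin.tail u) (u 0 + g (Fin.tail u))
  invFun u := Fin.cons (u (Fin.last m) + g (Fin.init u)) (Fin.init u)
  left_inv u := by
    simp [add_assoc, CharTwo.add_self_eq_zero]
  right_inv u := by
    simp [add_assoc, CharTwo.add_self_eq_zero]

theorem shiftPerm_apply {m : ℕ} (g : (Fin m → ZMod 2) → ZMod 2) (u : Fin (m + 1) → ZMod 2) :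
    shiftPerm g u = Fin.snoc (Fin.tail u) (u 0 + g (Fin.tail u)) := rfl

/-- The matrix `P - 1 ⊗ e_r`, where `P` is the transition matrix of the random walk that shifts a
word and appends a uniformly random bit. -/
def shiftWalk (m : ℕ) (r : Fin (m + 1) → ZMod 2) :
    Matrix (Fin (m + 1) → ZMod 2) (Fin (m + 1) → ZMod 2) ℚ :=
  Matrix.of fun u => (1 / 2 : ℚ) •
    (Pi.single (Fin.snoc (Fin.tail u) 0 : Fin (m + 1) → ZMod 2) 1 +
      Pi.single (Fin.snoc (Fin.tail u) 1 : Fin (m + 1) → ZMod 2) 1) - Pi.single r 1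

theorem shiftWalk_mulVec (m : ℕ) (r u : Fin (m + 1) → ZMod 2)
    (h : (Fin (m + 1) → ZMod 2) → ℚ) :
    (shiftWalk m r).mulVec h u =
      1 / 2 * (h (Fin.snoc (Fin.tail u) 0) + h (Fin.snoc (Fin.tail u) 1)) - h r := by
  change ((1 / 2 : ℚ) • (Pi.single (Fin.snoc (Fin.tail u) 0 : Fin (m + 1) → ZMod 2) 1 +
    Pi.single (Fin.snoc (Fin.tail u) 1 : Fin (m + 1) → ZMod 2) 1) - Pi.single r 1) ⬝ᵥ h = _
  rw [sub_dotProduct, smul_dotProduct, add_dotProduct]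
  simp

/-- Each step of the walk forgets one more letter, so that after `m + 1` steps a function has become
constant; constants are in the kernel. -/
theorem isNilpotent_shiftWalk (m : ℕ) (r : Fin (m + 1) → ZMod 2) :
    IsNilpotent (shiftWalk m r) := by
  refine ⟨m + 2, ?_⟩
  have key : ∀ (h : (Fin (m + 1) → ZMod 2) → ℚ) (k : ℕ) (u u' : Fin (m + 1) → ZMod 2),
      (∀ i : Fin (m + 1), k ≤ i → u i = u' i) →
      ((shiftWalk m r) ^ k).mulVec h u = ((shiftWalk m r) ^ k).mulVec h u' := by
    intro h k
    induction k with
    | zero => intro u u' huu; rw [funext fun i => huu i (Nat.zero_le _)]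
    | succ k ih =>
      intro u u' huu
      rw [pow_succ', ← Matrix.mulVec_mulVec, shiftWalk_mulVec, shiftWalk_mulVec]
      have : ∀ c : ZMod 2, ((shiftWalk m r) ^ k).mulVec h (Fin.snoc (Fin.tail u) c) =
          ((shiftWalk m r) ^ k).mulVec h (Fin.snoc (Fin.tail u') c) := by
        refine fun c => ih _ _ fun i hi => ?_
        induction i using Fin.lastCases with
        | last => simp
        | cast i =>
          simp only [Fin.snoc_castSucc, Fin.tail]
          exact huu _ (by simpa using hi)
      rw [this, this]
  refine Matrix.ext_of_mulVec_single fun v => ?_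
  funext u
  rw [pow_succ', ← Matrix.mulVec_mulVec, shiftWalk_mulVec]
  have hconst := fun w => key (Pi.single v 1) (m + 1) w r fun i hi => absurd i.2 (by omega)
  rw [hconst, hconst (Fin.snoc _ 1)]
  simp
  ring

theorem sum_det_rootedLaplacian (m : ℕ) (r : Fin (m + 1) → ZMod 2) :
    ∑ g : (Fin m → ZMod 2) → ZMod 2, (rootedLaplacian (shiftPerm g) r).det = 2 ^ 2 ^ m := by
  classical
  -- A matrix is handled as the family of its pairs of rows `cons 0 w`, `cons 1 w`.
  let mat : ((Fin m → ZMod 2) → ZMod 2 → (Fin (m + 1) → ZMod 2) → ℚ) →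
      Matrix (Fin (m + 1) → ZMod 2) (Fin (m + 1) → ZMod 2) ℚ :=
    fun x => Matrix.of fun u => x (Fin.tail u) (u 0)
  have hmat : ∀ x u, mat x u = x (Fin.tail u) (u 0) := fun _ _ => rfl
  let α : (Fin m → ZMod 2) → ZMod 2 → (Fin (m + 1) → ZMod 2) → ℚ :=
    fun w b => Pi.single (Fin.cons b w : Fin (m + 1) → ZMod 2) 1 + Pi.single r 1
  let γ : (Fin m → ZMod 2) → ZMod 2 → (Fin (m + 1) → ZMod 2) → ℚ :=
    fun w b => Pi.single (Fin.snoc w b : Fin (m + 1) → ZMod 2) 1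
  have hupd : ∀ x w (p : ZMod 2 → (Fin (m + 1) → ZMod 2) → ℚ), mat (Function.update x w p) =
      ((mat x).updateRow (Fin.cons 0 w) (p 0)).updateRow (Fin.cons 1 w) (p 1) := by
    intro x w p
    refine funext fun u => ?_
    induction u using Fin.consCases with
    | _ b t =>
    by_cases ht : t = w
    · subst ht
      have hne : (Fin.cons 0 t : Fin (m + 1) → ZMod 2) ≠ Fin.cons 1 t := by
        simp [Fin.cons_inj]
      have hb : b = 0 ∨ b = 1 := by revert b; decide
      rcases hb with rfl | rfl
      · rw [Matrix.updateRow_ne hne, Matrix.updateRow_self, hmat]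
        simp
      · rw [Matrix.updateRow_self, hmat]
        simp
    · have h : ∀ c, (Fin.cons b t : Fin (m + 1) → ZMod 2) ≠ Fin.cons c w := fun c hc =>
        ht (Fin.cons_inj.1 hc).2
      rw [Matrix.updateRow_ne (h 1), Matrix.updateRow_ne (h 0), hmat, hmat]
      simp [ht]
  have havg := sum_choices_eq_of_average (fun x => (mat x).det)
    (fun w c b => α w b - γ w (b + c)) (fun w b => α w b - (1 / 2 : ℚ) • (γ w 0 + γ w 1))
    (by
      intro x w
      simp only [hupd]
      have hne : (Fin.cons 0 w : Fin (m + 1) → ZMod 2) ≠ Fin.cons 1 w := by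
        simp [Fin.cons_inj]
      have h := det_updateRow_pair_add (mat x) hne (α w 0) (α w 1) (γ w 0) (γ w 1)
      have h11 : (1 : ZMod 2) + 1 = 0 := by decide
      simpa [h11] using h)
  have hcard : Fintype.card (Fin m → ZMod 2) = 2 ^ m := by simp [ZMod.card]
  have hmean : mat (fun w b => α w b - (1 / 2 : ℚ) • (γ w 0 + γ w 1)) = 1 - shiftWalk m r := by
    refine funext fun u => ?_
    have h1 : (1 : Matrix (Fin (m + 1) → ZMod 2) (Fin (m + 1) → ZMod 2) ℚ) u = Pi.single u 1 := by
      funext v; simp [Matrix.one_apply, Pi.single_apply, eq_comm]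
    change (α (Fin.tail u) (u 0) - (1 / 2 : ℚ) • (γ (Fin.tail u) 0 + γ (Fin.tail u) 1)) =
      (1 : Matrix (Fin (m + 1) → ZMod 2) (Fin (m + 1) → ZMod 2) ℚ) u - shiftWalk m r u
    have h2 : shiftWalk m r u = (1 / 2 : ℚ) • (γ (Fin.tail u) 0 + γ (Fin.tail u) 1) -
      Pi.single r 1 := rfl
    rw [h1, h2]
    simp only [α, Fin.cons_self_tail]
    abel
  rw [hmean, det_one_sub_of_isNilpotent _ (isNilpotent_shiftWalk m r), hcard, mul_one] at havg
  rw [← havg]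
  refine Finset.sum_congr rfl fun g _ => ?_
  congr 1
  refine funext fun u => ?_
  simp [rootedLaplacian, mat, α, γ, shiftPerm_apply]

/-- The number of cyclic nonsingular feedback shift registers of order `m + 1`. -/
theorem ncard_isCycleOn_shiftPerm (m : ℕ) :
    {g : (Fin m → ZMod 2) → ZMod 2 | (shiftPerm g).IsCycleOn Set.univ}.ncard =
      2 ^ (2 ^ m - (m + 1)) := by
  classical
  have h := sum_det_rootedLaplacian m 0
  have hg : ∀ g : (Fin m → ZMod 2) → ZMod 2, (rootedLaplacian (shiftPerm g) 0).det =
      if (shiftPerm g).IsCycleOn Set.univ then (2 : ℚ) ^ (m + 1) else 0 := fun g => by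
    split_ifs with hc
    · rw [det_rootedLaplacian_eq_card _ _ hc]; simp [ZMod.card]
    · exact det_rootedLaplacian_eq_zero _ _ hc
  rw [Finset.sum_congr rfl fun g _ => hg g, Finset.sum_ite, Finset.sum_const_zero, add_zero,
    Finset.sum_const, nsmul_eq_mul] at h
  have hle : m + 1 ≤ 2 ^ m := Nat.lt_two_pow_self
  rw [Set.ncard_eq_toFinset_card', Set.toFinset_ofPred]
  have h' : ((Finset.univ.filter fun g : (Fin m → ZMod 2) → ZMod 2 =>
      (shiftPerm g).IsCycleOn Set.univ).card) * 2 ^ (m + 1) = 2 ^ 2 ^ m := by exact_mod_cast h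
  refine Nat.eq_of_mul_eq_mul_right (Nat.two_pow_pos (m + 1)) ?_
  rw [h', ← pow_add, Nat.sub_add_cancel hle]

/-! ### Closed walks through all binary words -/

/-- The closed walks, started at the zero word, that shift a word and append a letter in each step
and visit every binary word of length `m + 1` exactly once per period. -/
def deBruijnWalks (m : ℕ) : Set (ℕ → Fin (m + 1) → ZMod 2) :=
  {y | y 0 = 0 ∧ (∀ t, Fin.init (y (t + 1)) = Fin.tail (y t)) ∧
    (∀ t, y (t + 2 ^ (m + 1)) = y t) ∧ Set.InjOn y (Set.Iio (2 ^ (m + 1)))}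

/-- Equality in terms of residues, for a sequence with least period `N` without repetitions. -/
theorem periodic_apply_eq_iff_modEq {α : Type*} {y : ℕ → α} {N : ℕ} (hN : 0 < N)
    (hp : ∀ t, y (t + N) = y t) (hi : Set.InjOn y (Set.Iio N)) (s t : ℕ) :
    y s = y t ↔ s ≡ t [MOD N] := by
  have hmod : ∀ t, y (t % N) = y t := fun t => Function.Periodic.map_mod_nat hp t
  rw [← hmod s, ← hmod t]
  exact ⟨fun h => hi (Nat.mod_lt _ hN) (Nat.mod_lt _ hN) h, fun h => congrArg y h⟩

theorem deBruijnWalks.apply_eq_iff {m : ℕ} {y : ℕ → Fin (m + 1) → ZMod 2}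
    (hy : y ∈ deBruijnWalks m) (s t : ℕ) : y s = y t ↔ s ≡ t [MOD 2 ^ (m + 1)] :=
  periodic_apply_eq_iff_modEq (by positivity) hy.2.2.1 hy.2.2.2 s t

theorem deBruijnWalks.existsUnique_add {m : ℕ} {y : ℕ → Fin (m + 1) → ZMod 2}
    (hy : y ∈ deBruijnWalks m) (c : ℕ) (w : Fin (m + 1) → ZMod 2) :
    ∃! i, i < 2 ^ (m + 1) ∧ y (i + c) = w := by
  have hb : Function.Bijective (fun i : Fin (2 ^ (m + 1)) => y (i + c)) := by
    refine (Fintype.bijective_iff_injective_and_card _).2 ⟨fun i j hij => ?_, by simp [ZMod.card]⟩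
    have h := Nat.ModEq.add_right_cancel' c ((deBruijnWalks.apply_eq_iff hy _ _).1 hij)
    exact Fin.ext (Nat.ModEq.eq_of_lt_of_lt h i.2 j.2)
  obtain ⟨i, hi, hu⟩ := hb.existsUnique w
  exact ⟨i, ⟨i.2, hi⟩, fun j hj => congrArg Fin.val (hu ⟨j, hj.1⟩ hj.2)⟩

/-- Along a walk of shifts, a word consists of the letters appended in the last `m + 1` steps. -/
theorem apply_add_eq_last_of_shift {m : ℕ} {y : ℕ → Fin (m + 1) → ZMod 2}
    (hs : ∀ t, Fin.init (y (t + 1)) = Fin.tail (y t)) (t : ℕ) (j : Fin (m + 1)) :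
    y (t + (m + 1)) j = y (t + j + 1) (Fin.last m) := by
  have key : ∀ (k t : ℕ) (i j : Fin (m + 1)), (i : ℕ) = j + k → y (t + k) j = y t i := by
    intro k
    induction k with
    | zero => intro t i j h; rw [Fin.ext (by simpa using h) (a := i)]; rfl
    | succ k ih =>
      intro t i j h
      have hj : (j : ℕ) < m := by omega
      have h1 := congrFun (hs (t + k)) ⟨j, hj⟩
      rw [← ih t i (Fin.succ ⟨j, hj⟩) (by simp; omega)]
      exact h1
  rw [← key (m - j) (t + j + 1) (Fin.last m) j (by simp; omega)]
  exact congrFun (congrArg y (by omega)) j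

theorem shiftPerm_injective (m : ℕ) : Function.Injective (shiftPerm (m := m)) := by
  intro g g' h
  funext w
  have := congrFun (DFunLike.congr_fun h (Fin.cons 0 w)) (Fin.last m)
  simpa [shiftPerm_apply] using this

theorem pow_shiftPerm_mem_deBruijnWalks {m : ℕ} {g : (Fin m → ZMod 2) → ZMod 2}
    (hg : (shiftPerm g).IsCycleOn Set.univ) :
    (fun t => (shiftPerm g ^ t) 0) ∈ deBruijnWalks m := by
  have hc : (shiftPerm g).IsCycleOn ((Finset.univ : Finset (Fin (m + 1) → ZMod 2)) : Set _) := by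
    simpa using hg
  have hcard : (Finset.univ : Finset (Fin (m + 1) → ZMod 2)).card = 2 ^ (m + 1) := by
    simp [ZMod.card]
  have hiff := fun s t => hc.pow_apply_eq_pow_apply (Finset.mem_univ 0) (m := s) (n := t)
  rw [hcard] at hiff
  refine ⟨rfl, fun t => ?_, fun t => ?_, fun s hs t ht hst => ?_⟩
  · simp only [pow_succ', Equiv.Perm.mul_apply, shiftPerm_apply (u := (shiftPerm g ^ t) 0)]
    simp
  · exact (hiff _ _).2 (by simp [Nat.ModEq])
  · exact Nat.ModEq.eq_of_lt_of_lt ((hiff _ _).1 hst) hs ht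

theorem exists_eq_pow_shiftPerm {m : ℕ} {y : ℕ → Fin (m + 1) → ZMod 2}
    (hy : y ∈ deBruijnWalks m) :
    ∃ g : (Fin m → ZMod 2) → ZMod 2, (shiftPerm g).IsCycleOn Set.univ ∧
      ∀ t, y t = (shiftPerm g ^ t) 0 := by
  choose T hT using fun w => (deBruijnWalks.existsUnique_add hy 0 w).exists
  have hTy : ∀ w, y (T w) = w := fun w => (hT w).2
  have hnext : ∀ s t, y (s + 1) = y (t + 1) ↔ y s = y t := fun s t => by
    rw [deBruijnWalks.apply_eq_iff hy, deBruijnWalks.apply_eq_iff hy]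
    exact ⟨Nat.ModEq.add_right_cancel' 1, Nat.ModEq.add_right 1⟩
  have hsnoc : ∀ t, y (t + 1) = Fin.snoc (Fin.tail (y t)) (y (t + 1) (Fin.last m)) := fun t => by
    rw [← hy.2.1 t, Fin.snoc_init_self]
  let g : (Fin m → ZMod 2) → ZMod 2 := fun w => y (T (Fin.cons 0 w) + 1) (Fin.last m)
  have hstep : ∀ t, y (t + 1) = shiftPerm g (y t) := by
    intro t
    have h0 : y (T (Fin.cons 0 (Fin.tail (y t))) + 1) =
        Fin.snoc (Fin.tail (y t)) (g (Fin.tail (y t))) := by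
      rw [hsnoc, hTy]
      simp [g]
    rw [shiftPerm_apply]
    have hb : ∀ b : ZMod 2, b = 0 ∨ b = 1 := by decide
    rcases hb (y t 0) with h | h
    · rw [h, zero_add, ← h0, hnext, hTy, ← h, Fin.cons_self_tail]
    · -- The two words with the same tail have successors that differ in the last letter.
      have hne : y (t + 1) (Fin.last m) ≠ g (Fin.tail (y t)) := by
        intro he
        have h1 := hsnoc t
        rw [he, ← h0, hnext, hTy] at h1
        have := congrFun h1 0
        rw [h] at this
        simp at this
      have hx : ∀ b c : ZMod 2, b ≠ c → b = 1 + c := by decide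
      rw [h, ← hx _ _ hne]
      exact hsnoc t
  have hpow : ∀ t, y t = (shiftPerm g ^ t) 0 := by
    intro t
    induction t with
    | zero => exact hy.1
    | succ t ih => rw [hstep, ih, pow_succ', Equiv.Perm.mul_apply]
  have hsame : ∀ u, (shiftPerm g).SameCycle 0 u := fun u =>
    ⟨T u, by rw [zpow_natCast, ← hpow, hTy]⟩
  exact ⟨g, ⟨(shiftPerm g).bijective.bijOn_univ, fun u _ v _ => (hsame u).symm.trans (hsame v)⟩,
    hpow⟩

theorem ncard_deBruijnWalks (m : ℕ) : (deBruijnWalks m).ncard = 2 ^ (2 ^ m - (m + 1)) := by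
  rw [← ncard_isCycleOn_shiftPerm m]
  have himg : deBruijnWalks m = (fun (g : (Fin m → ZMod 2) → ZMod 2) t => (shiftPerm g ^ t) 0) ''
      {g | (shiftPerm g).IsCycleOn Set.univ} := by
    ext y
    constructor
    · intro hy
      obtain ⟨g, hg, h⟩ := exists_eq_pow_shiftPerm hy
      exact ⟨g, hg, funext fun t => (h t).symm⟩
    · rintro ⟨g, hg, rfl⟩
      exact pow_shiftPerm_mem_deBruijnWalks hg
  rw [himg]
  refine Set.InjOn.ncard_image fun g hg g' hg' h => shiftPerm_injective m ?_
  refine Equiv.ext fun u => ?_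
  obtain ⟨t, ht⟩ :=
    (deBruijnWalks.existsUnique_add (pow_shiftPerm_mem_deBruijnWalks hg) 0 u).exists
  have h1 := congrFun h t
  have h2 := congrFun h (t + 1)
  simp only [pow_succ', Equiv.Perm.mul_apply] at h1 h2
  have hu : (shiftPerm g ^ t) 0 = u := ht.2
  rwa [← h1, hu] at h2

/-! ### The de Bruijn sequence of a closed walk -/

theorem deBruijnWalks.isDeBruijn {m : ℕ} {y : ℕ → Fin (m + 1) → ZMod 2}
    (hy : y ∈ deBruijnWalks m) : IsDeBruijn (m + 1) fun t => y (t + 1) (Fin.last m) := by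
  have hwin := apply_add_eq_last_of_shift hy.2.1
  refine ⟨⟨⟨by positivity, fun i => ?_⟩, ?_⟩, fun w => ?_⟩
  · change y (i + 2 ^ (m + 1) + 1) _ = _
    rw [add_right_comm, hy.2.2.1]
  · rintro M ⟨hM, hper⟩
    have h : y (M + (m + 1)) = y (0 + (m + 1)) := by
      funext j
      rw [hwin, hwin]
      have := hper j
      rw [zero_add, add_comm M]
      exact this
    have h2 := Nat.ModEq.add_right_cancel' _ ((deBruijnWalks.apply_eq_iff hy _ _).1 h)
    exact Nat.le_of_dvd hM ((Nat.modEq_zero_iff_dvd).1 h2)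
  · have h := deBruijnWalks.existsUnique_add hy (m + 1) w
    simpa only [funext_iff, hwin] using h

/-- Two consecutive zero windows would be a repetition, so that no run of zeros is longer than a
word. -/
theorem deBruijnWalks.inLongestZeroRun {m : ℕ} {y : ℕ → Fin (m + 1) → ZMod 2}
    (hy : y ∈ deBruijnWalks m) :
    InLongestZeroRun (fun t => y (t + 1) (Fin.last m)) (2 ^ (m + 1) - 1) := by
  have hwin := apply_add_eq_last_of_shift hy.2.1
  have hlt : m + 1 < 2 ^ (m + 1) := Nat.lt_two_pow_self
  refine ⟨2 ^ (m + 1) - (m + 1), m + 1, fun j hj => ?_, fun a L hL => ?_, by omega, by omega⟩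
  · have h := hwin (2 ^ (m + 1) - (m + 1)) ⟨j, hj⟩
    have h0 : y (2 ^ (m + 1)) = 0 := by simpa [hy.1] using hy.2.2.1 0
    rw [Nat.sub_add_cancel hlt.le, h0] at h
    exact h.symm
  · by_contra! hlong
    have hz : ∀ b, b ≤ 1 → y (a + b + (m + 1)) = 0 := fun b hb => by
      funext j
      rw [hwin, add_assoc a b j]
      exact hL (b + j) (by omega)
    have h := (deBruijnWalks.apply_eq_iff hy _ _).1 ((hz 1 le_rfl).trans (hz 0 zero_le_one).symm)
    have h1 : 1 ≡ 0 [MOD 2 ^ (m + 1)] :=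
      Nat.ModEq.add_left_cancel' a (Nat.ModEq.add_right_cancel' _ h)
    have := Nat.ModEq.eq_of_lt_of_lt h1 (by omega) (by omega)
    omega

/-! ### Vertices as words of labels -/

/-- The word of length `m + 1` attached to a polynomial `a`: the coefficients of `(X + 1) a`, from
degree `m` down to degree `0`. For a vertex of `Γ_(m + 1)` these are the labels of the last `m + 1`
arcs of any walk that ends there, the oldest one first. -/
noncomputable def labelWord (m : ℕ) : (ZMod 2)[X] →ₗ[ZMod 2] (Fin (m + 1) → ZMod 2) :=
  LinearMap.pi fun j => lcoeff (ZMod 2) (m - j) ∘ₗ LinearMap.mulLeft (ZMod 2) (X + 1)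

theorem labelWord_apply (m : ℕ) (a : (ZMod 2)[X]) (j : Fin (m + 1)) :
    labelWord m a j = ((X + 1) * a).coeff (m - j) := rfl

theorem labelWord_last (m : ℕ) (a : (ZMod 2)[X]) : labelWord m a (Fin.last m) = a.coeff 0 := by
  simp [labelWord_apply, add_mul]

theorem eq_of_coeff_eq_of_degree_lt {n : ℕ} {a b : (ZMod 2)[X]} (ha : a.degree < n)
    (hb : b.degree < n) (h : ∀ k < n, a.coeff k = b.coeff k) : a = b := by
  ext k
  by_cases hk : k < n
  · exact h k hk
  · have hk : (n : WithBot ℕ) ≤ k := by exact_mod_cast not_lt.1 hk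
    rw [coeff_eq_zero_of_degree_lt (ha.trans_le hk), coeff_eq_zero_of_degree_lt (hb.trans_le hk)]

theorem eq_zero_of_labelWord_eq_zero {m : ℕ} {a : (ZMod 2)[X]} (ha : a.degree < (m + 1 : ℕ))
    (h : labelWord m a = 0) : a = 0 := by
  refine eq_of_coeff_eq_of_degree_lt ha (by simp) fun k => ?_
  have hc : ∀ k ≤ m, ((X + 1) * a).coeff k = 0 := fun k hk => by
    have := congrFun h ⟨m - k, by omega⟩
    rw [labelWord_apply] at this
    simpa [Nat.sub_sub_self hk] using this
  induction k with
  | zero => intro _; simpa [add_mul] using hc 0 (Nat.zero_le _)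
  | succ k ih =>
    intro hk
    have h1 := hc (k + 1) (by omega)
    rw [add_mul, coeff_add, coeff_X_mul, one_mul, ih (by omega)] at h1
    simpa using h1

theorem exists_labelWord_eq (m : ℕ) (w : Fin (m + 1) → ZMod 2) :
    ∃ a : (ZMod 2)[X], a.degree < (m + 1 : ℕ) ∧ labelWord m a = w := by
  let f := (labelWord m).domRestrict (degreeLT (ZMod 2) (m + 1))
  have hfin : Module.finrank (ZMod 2) (degreeLT (ZMod 2) (m + 1)) =
      Module.finrank (ZMod 2) (Fin (m + 1) → ZMod 2) :=
    LinearEquiv.finrank_eq (degreeLTEquiv (ZMod 2) (m + 1))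
  have : FiniteDimensional (ZMod 2) (degreeLT (ZMod 2) (m + 1)) :=
    LinearEquiv.finiteDimensional (degreeLTEquiv (ZMod 2) (m + 1)).symm
  have hinj : Function.Injective f := by
    refine (injective_iff_map_eq_zero f).2 fun a ha => Subtype.ext ?_
    exact eq_zero_of_labelWord_eq_zero (mem_degreeLT.1 a.2) ha
  obtain ⟨a, ha⟩ := (LinearMap.injective_iff_surjective_of_finrank_eq_finrank hfin).1 hinj w
  exact ⟨a, mem_degreeLT.1 a.2, ha⟩

/-- The word of labels of a vertex. -/
noncomputable def vertexWord {m : ℕ} (a : Omega (m + 1)) : Fin (m + 1) → ZMod 2 :=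
  labelWord m a

theorem vertexWord_ne_zero {m : ℕ} (a : Omega (m + 1)) : vertexWord a ≠ 0 := fun h =>
  a.2.1 (eq_zero_of_labelWord_eq_zero a.2.2 h)

theorem vertexWord_injective (m : ℕ) : Function.Injective (vertexWord (m := m)) := by
  intro a b hab
  refine Subtype.ext (sub_eq_zero.1 (eq_zero_of_labelWord_eq_zero (m := m) ?_ ?_))
  · exact (degree_sub_le _ _).trans_lt (max_lt a.2.2 b.2.2)
  · rw [map_sub, sub_eq_zero]; exact hab

theorem exists_vertexWord_eq {m : ℕ} {w : Fin (m + 1) → ZMod 2} (hw : w ≠ 0) :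
    ∃ a : Omega (m + 1), vertexWord a = w := by
  obtain ⟨a, ha, haw⟩ := exists_labelWord_eq m w
  refine ⟨⟨a, ?_, ha⟩, haw⟩
  rintro rfl
  exact hw (haw.symm.trans (map_zero _))

theorem degree_double_lt (n : ℕ) (a : (ZMod 2)[X]) : (double n a).degree < n := by
  have h := degree_modByMonic_lt (X * a) (monic_X_pow (R := ZMod 2) n)
  rwa [degree_X_pow] at h

theorem coeff_double {n k : ℕ} (hk : k < n) (a : (ZMod 2)[X]) :
    (double n a).coeff k = (X * a).coeff k := by
  conv_rhs => rw [← modByMonic_add_div (X * a) (X ^ n)]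
  rw [coeff_add, coeff_X_pow_mul', if_neg (by omega), add_zero, double]

theorem degree_doubleComplement_lt (n : ℕ) (a : (ZMod 2)[X]) :
    (doubleComplement n a).degree < n := by
  refine (degree_add_le _ _).trans_lt (max_lt (degree_double_lt n a) ?_)
  refine (degree_sum_le _ _).trans_lt ((Finset.sup_lt_iff (WithBot.bot_lt_coe n)).2 fun i hi => ?_)
  rw [degree_X_pow]
  exact Nat.cast_lt.2 (Finset.mem_range.1 hi)

theorem coeff_doubleComplement {n k : ℕ} (hk : k < n) (a : (ZMod 2)[X]) :
    (doubleComplement n a).coeff k = (X * a).coeff k + 1 := by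
  rw [doubleComplement, coeff_add, ← double, coeff_double hk, finsetSum_coeff]
  simp [coeff_X_pow, hk]

/-- Both kinds of arcs add the constant term of the new vertex to every coefficient of the shifted
polynomial. -/
theorem Gamma_adj_iff_coeff {m : ℕ} (a b : Omega (m + 1)) : (Gamma (m + 1)).Adj a b ↔
    ∀ k < m + 1, (b : (ZMod 2)[X]).coeff k = (X * (a : (ZMod 2)[X])).coeff k +
      (b : (ZMod 2)[X]).coeff 0 := by
  constructor
  · rintro (h | h) k hk
    · rw [h, coeff_double hk, coeff_double (Nat.succ_pos m)]; simp
    · rw [h, coeff_doubleComplement hk, coeff_doubleComplement (Nat.succ_pos m)]; simp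
  · intro h
    have hb : ∀ c : ZMod 2, c = 0 ∨ c = 1 := by decide
    rcases hb ((b : (ZMod 2)[X]).coeff 0) with h0 | h0
    · refine Or.inl (eq_of_coeff_eq_of_degree_lt b.2.2 (degree_double_lt _ _) fun k hk => ?_)
      rw [coeff_double hk, h k hk, h0, add_zero]
    · refine Or.inr (eq_of_coeff_eq_of_degree_lt b.2.2 (degree_doubleComplement_lt _ _)
        fun k hk => ?_)
      rw [coeff_doubleComplement hk, h k hk, h0]

/-- In terms of words of labels, the arcs of `Γ_(m + 1)` are those of the de Bruijn graph. -/
theorem Gamma_adj_iff {m : ℕ} (a b : Omega (m + 1)) :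
    (Gamma (m + 1)).Adj a b ↔ Fin.init (vertexWord b) = Fin.tail (vertexWord a) := by
  have hword : Fin.init (vertexWord b) = Fin.tail (vertexWord a) ↔
      ∀ k < m, ((X + 1) * (b : (ZMod 2)[X])).coeff (k + 1) =
        ((X + 1) * (a : (ZMod 2)[X])).coeff k := by
    constructor
    · intro h k hk
      have := congrFun h ⟨m - (k + 1), by omega⟩
      simp only [Fin.init, Fin.tail, vertexWord, labelWord_apply, Fin.val_castSucc,
        Fin.val_succ] at this
      rwa [show m - (m - (k + 1)) = k + 1 by omega,
        show m - (m - (k + 1) + 1) = k by omega] at this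
    · intro h
      funext j
      simp only [Fin.init, Fin.tail, vertexWord, labelWord_apply, Fin.val_castSucc, Fin.val_succ]
      rw [← h _ (by omega)]
      congr 1
      omega
  rw [hword, Gamma_adj_iff_coeff]
  constructor
  · intro h k hk
    have h1 := h (k + 1) (by omega)
    have h3 := h k (by omega)
    rw [coeff_X_mul] at h1
    rw [add_mul, add_mul, coeff_add, coeff_add, coeff_X_mul, one_mul, one_mul, h1, h3]
    linear_combination (b : (ZMod 2)[X]).coeff 0 * (CharTwo.two_eq_zero : (2 : ZMod 2) = 0)
  · intro h k
    induction k with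
    | zero => intro _; simp
    | succ k ih =>
      intro hk
      have h1 := h k (by omega)
      rw [add_mul, add_mul, coeff_add, coeff_add, coeff_X_mul, one_mul, one_mul] at h1
      rw [coeff_X_mul]
      linear_combination h1 - ih (by omega) - (b : (ZMod 2)[X]).coeff 0 *
        (CharTwo.two_eq_zero : (2 : ZMod 2) = 0)

theorem arcLabel_eq_last {m : ℕ} {a b : Omega (m + 1)} (h : (Gamma (m + 1)).Adj a b) :
    arcLabel (m + 1) a b = vertexWord b (Fin.last m) := by
  rw [vertexWord, labelWord_last, arcLabel]
  split_ifs with h0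
  · rw [h0, coeff_double (Nat.succ_pos m)]; simp
  · rw [h.resolve_left h0, coeff_doubleComplement (Nat.succ_pos m)]; simp

theorem natCard_Omega (m : ℕ) : Nat.card (Omega (m + 1)) = 2 ^ (m + 1) - 1 := by
  have h : Nat.card (Omega (m + 1)) = Nat.card {w : Fin (m + 1) → ZMod 2 // w ≠ 0} :=
    Nat.card_congr (Equiv.ofBijective (fun a => ⟨vertexWord a, vertexWord_ne_zero a⟩)
      ⟨fun a b hab => vertexWord_injective m (congrArg Subtype.val hab), fun w => by
        obtain ⟨a, ha⟩ := exists_vertexWord_eq w.2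
        exact ⟨a, Subtype.ext ha⟩⟩)
  rw [h, Nat.card_eq_fintype_card, Fintype.card_subtype_compl]
  simp [ZMod.card]

/-! ### Hamiltonian cycles -/

theorem List.rotate_map_range_of_periodic {α : Type*} {v : ℕ → α} {L : ℕ}
    (hv : ∀ i, v (i + L) = v i) (k : ℕ) :
    ((List.range L).map v).rotate k = (List.range L).map fun i => v (i + k) := by
  refine List.ext_getElem (by simp) fun i h1 h2 => ?_
  rw [List.getElem_rotate]
  simp only [List.getElem_map, List.getElem_range, List.length_map, List.length_range]
  exact Function.Periodic.map_mod_nat hv (i + k)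

/-- Every nonempty cycle is listed by a periodic sequence. -/
theorem Cycle.exists_eq_map_range {α : Type*} (H : Cycle α) (hH : 0 < H.length) :
    ∃ v : ℕ → α, H = (((List.range H.length).map v : List α) : Cycle α) ∧
      ∀ i, v (i + H.length) = v i := by
  induction H using Quotient.inductionOn' with
  | h l =>
    change 0 < l.length at hH
    refine ⟨fun i => l[i % l.length]'(Nat.mod_lt _ hH), ?_, fun i => ?_⟩
    · change (l : Cycle α) = (((List.range l.length).map _ : List α) : Cycle α)
      congr 1
      refine List.ext_getElem (by simp) fun i h1 h2 => ?_
      simp [Nat.mod_eq_of_lt h1]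
    · change l[(i + l.length) % l.length]'_ = _
      simp

theorem IsHamiltonianCycle.length_eq {m : ℕ} {H : Cycle (Omega (m + 1))}
    (hH : IsHamiltonianCycle (Gamma (m + 1)) H) : H.length = 2 ^ (m + 1) - 1 := by
  classical
  rw [← natCard_Omega m]
  obtain ⟨hnd, hall, -⟩ := hH
  induction H using Quotient.inductionOn' with
  | h l =>
    have hfin : (l.toFinset : Set (Omega (m + 1))) = Set.univ :=
      Set.eq_univ_of_forall fun v => by simpa using hall v
    rw [← Set.ncard_univ, ← hfin, Set.ncard_coe_finset]
    exact (List.toFinset_card_of_nodup hnd).symm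

/-- `v` lists the vertices of a Hamiltonian cycle of `Γ_(m + 1)` periodically. Every vertex is
reached, because the period is the number of vertices. -/
structure ListsHamiltonianCycle {m : ℕ} (v : ℕ → Omega (m + 1)) : Prop where
  periodic : ∀ i, v (i + (2 ^ (m + 1) - 1)) = v i
  injOn : Set.InjOn v (Set.Iio (2 ^ (m + 1) - 1))
  adj : ∀ i, (Gamma (m + 1)).Adj (v i) (v (i + 1))

theorem one_lt_two_pow_succ (m : ℕ) : 1 < 2 ^ (m + 1) :=
  Nat.one_lt_two_pow (Nat.succ_ne_zero m)

theorem chain_map_range_iff {m L : ℕ} {v : ℕ → Omega (m + 1)} (hL : 0 < L)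
    (hv : ∀ i, v (i + L) = v i) :
    Cycle.Chain (Gamma (m + 1)).Adj (((List.range L).map v : List (Omega (m + 1))) : Cycle _) ↔
      ∀ i, (Gamma (m + 1)).Adj (v i) (v (i + 1)) := by
  obtain ⟨k, rfl⟩ := Nat.exists_eq_succ_of_ne_zero hL.ne'
  rw [← Cycle.map_coe, Cycle.chain_map, Cycle.chain_range_succ]
  have hend : v (k + 1) = v 0 := by simpa using hv 0
  constructor
  · rintro ⟨h0, h⟩ i
    have hmod : ∀ i, v (i % (k + 1)) = v i := fun i => Function.Periodic.map_mod_nat hv i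
    have hstep : ∀ j < k + 1, (Gamma (m + 1)).Adj (v j) (v (j + 1)) := fun j hj => by
      rcases Nat.lt_succ_iff_lt_or_eq.1 hj with hj | rfl
      · exact h j hj
      · rwa [hend]
    have := hstep (i % (k + 1)) (Nat.mod_lt _ hL)
    rwa [← hmod (i % (k + 1) + 1), Nat.mod_add_mod, hmod, hmod] at this
  · intro h
    exact ⟨by simpa [hend] using h k, fun j _ => h j⟩

theorem IsHamiltonianCycle.lists {m : ℕ} {H : Cycle (Omega (m + 1))}
    (hH : IsHamiltonianCycle (Gamma (m + 1)) H) {v : ℕ → Omega (m + 1)}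
    (hHv : H = (((List.range H.length).map v : List (Omega (m + 1))) : Cycle (Omega (m + 1))))
    (hv : ∀ i, v (i + H.length) = v i) : ListsHamiltonianCycle v := by
  have hlen := hH.length_eq
  rw [hlen] at hHv hv
  obtain ⟨hnd, -, hch⟩ := hH
  rw [hHv] at hnd hch
  refine ⟨hv, fun i hi j hj hij => ?_, ?_⟩
  · rw [Cycle.nodup_coe_iff] at hnd
    exact List.inj_on_of_nodup_map hnd (by simpa using hi) (by simpa using hj) hij
  · exact (chain_map_range_iff (by have := one_lt_two_pow_succ m; omega) hv).1 hch

theorem ListsHamiltonianCycle.isHamiltonianCycle {m : ℕ} {v : ℕ → Omega (m + 1)}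
    (hv : ListsHamiltonianCycle v) : IsHamiltonianCycle (Gamma (m + 1))
      (((List.range (2 ^ (m + 1) - 1)).map v : List (Omega (m + 1))) : Cycle (Omega (m + 1))) := by
  classical
  have hpos : 0 < 2 ^ (m + 1) - 1 := by have := one_lt_two_pow_succ m; omega
  have hnd : ((List.range (2 ^ (m + 1) - 1)).map v).Nodup :=
    List.Nodup.map_on (fun i hi j hj hij => hv.injOn (by simpa using hi) (by simpa using hj) hij)
      List.nodup_range
  refine ⟨Cycle.nodup_coe_iff.2 hnd, fun a => ?_, (chain_map_range_iff hpos hv.periodic).2 hv.adj⟩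
  have : Finite (Omega (m + 1)) := Nat.finite_of_card_ne_zero (by rw [natCard_Omega]; omega)
  have h : (((List.range (2 ^ (m + 1) - 1)).map v).toFinset : Set (Omega (m + 1))) = Set.univ := by
    refine Set.eq_of_subset_of_ncard_le (Set.subset_univ _) ?_
    rw [Set.ncard_univ, Set.ncard_coe_finset, List.toFinset_card_of_nodup hnd, natCard_Omega]
    simp
  rw [Cycle.mem_coe_iff, ← List.mem_toFinset, ← Finset.mem_coe, h]
  trivial

theorem ListsHamiltonianCycle.exists_apply_eq {m : ℕ} {v : ℕ → Omega (m + 1)}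
    (hv : ListsHamiltonianCycle v) (a : Omega (m + 1)) : ∃ q, v q = a := by
  have h := hv.isHamiltonianCycle.2.1 a
  rw [Cycle.mem_coe_iff, List.mem_map] at h
  obtain ⟨q, -, hq⟩ := h
  exact ⟨q, hq⟩

/-- The walk through all words that follows the vertices `v (q + 1), v (q + 2), …` and makes a
detour through the zero word once per round. -/
noncomputable def insertZero {m : ℕ} (v : ℕ → Omega (m + 1)) (q t : ℕ) : Fin (m + 1) → ZMod 2 :=
  if t % 2 ^ (m + 1) = 0 then 0 else vertexWord (v (q + t % 2 ^ (m + 1)))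

theorem insertZero_succ {m : ℕ} (v : ℕ → Omega (m + 1)) (q : ℕ) {t : ℕ}
    (ht : t < 2 ^ (m + 1) - 1) : insertZero v q (t + 1) = vertexWord (v (q + 1 + t)) := by
  have h : (t + 1) % 2 ^ (m + 1) = t + 1 := Nat.mod_eq_of_lt (by omega)
  rw [insertZero, h, if_neg (Nat.succ_ne_zero t), add_right_comm, add_assoc]

/-- The zero word fits between `10…0` and `0…01`. -/
theorem insertZero_mem_deBruijnWalks {m : ℕ} {v : ℕ → Omega (m + 1)}
    (hv : ListsHamiltonianCycle v) {q : ℕ} (hq : vertexWord (v q) = Fin.cons 1 0) :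
    insertZero v q ∈ deBruijnWalks m := by
  have hlt := one_lt_two_pow_succ m
  set N := 2 ^ (m + 1) with hN
  have hzero : insertZero v q 0 = 0 := by simp [insertZero]
  have hper : ∀ t, insertZero v q (t + N) = insertZero v q t := fun t => by
    simp [insertZero, ← hN]
  have hmod : ∀ t, insertZero v q (t % N) = insertZero v q t := fun t =>
    Function.Periodic.map_mod_nat hper t
  have hpos : ∀ t, 0 < t → t < N → insertZero v q t = vertexWord (v (q + t)) := by
    intro t h0 h1
    rw [insertZero, Nat.mod_eq_of_lt h1, if_neg h0.ne']
  have hstep : ∀ t < N, Fin.init (insertZero v q (t + 1)) = Fin.tail (insertZero v q t) := by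
    intro t ht
    rcases Nat.eq_zero_or_pos t with rfl | h0
    · rw [zero_add, hpos _ one_pos hlt, (Gamma_adj_iff _ _).1 (hv.adj q), hq, hzero]
      simp
      rfl
    · rw [hpos t h0 ht]
      rcases Nat.lt_or_ge (t + 1) N with h1 | h1
      · rw [hpos _ (Nat.succ_pos t) h1]
        exact (Gamma_adj_iff _ _).1 (hv.adj (q + t))
      · have h2 : t = N - 1 := by omega
        have h3 : insertZero v q (N - 1 + 1) = 0 := by
          rw [Nat.sub_add_cancel hlt.le, ← hzero, ← hper 0, zero_add]
        rw [h2, h3, hv.periodic, hq]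
        simp
        rfl
  refine ⟨hzero, fun t => ?_, hper, fun s hs t ht hst => ?_⟩
  · rw [← hmod t, ← hstep _ (Nat.mod_lt t (by omega)), ← hmod (t + 1), ← hmod (t % N + 1),
      Nat.mod_add_mod]
  · have hs : s < N := hs
    have ht : t < N := ht
    rcases Nat.eq_zero_or_pos s with rfl | h0 <;> rcases Nat.eq_zero_or_pos t with rfl | h1
    · rfl
    · rw [hzero, hpos t h1 ht] at hst
      exact absurd hst.symm (vertexWord_ne_zero _)
    · rw [hzero, hpos s h0 hs] at hst
      exact absurd hst (vertexWord_ne_zero _)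
    · rw [hpos s h0 hs, hpos t h1 ht] at hst
      have h := (periodic_apply_eq_iff_modEq (by omega) hv.periodic hv.injOn _ _).1
        (vertexWord_injective m hst)
      have h2 := Nat.ModEq.add_left_cancel' q h
      -- Both numbers lie between `1` and `N - 1`, a full set of residues modulo `N - 1`.
      have h3 : s - 1 ≡ t - 1 [MOD N - 1] := by
        refine Nat.ModEq.add_right_cancel' 1 ?_
        rwa [Nat.sub_add_cancel h0, Nat.sub_add_cancel h1]
      have := Nat.ModEq.eq_of_lt_of_lt h3 (by omega) (by omega)
      omega

theorem ListsHamiltonianCycle.exists_insertZero_mem {m : ℕ} {v : ℕ → Omega (m + 1)}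
    (hv : ListsHamiltonianCycle v) : ∃ q, insertZero v q ∈ deBruijnWalks m := by
  have hne : (Fin.cons 1 0 : Fin (m + 1) → ZMod 2) ≠ 0 := fun h => by
    simpa using congrFun h 0
  obtain ⟨a, ha⟩ := exists_vertexWord_eq hne
  obtain ⟨q, rfl⟩ := hv.exists_apply_eq a
  exact ⟨q, insertZero_mem_deBruijnWalks hv ha⟩

/-! ### The label sequence of a Hamiltonian cycle -/

theorem ListsHamiltonianCycle.isModifiedDeBruijn {m : ℕ} {v : ℕ → Omega (m + 1)}
    (hv : ListsHamiltonianCycle v) :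
    IsModifiedDeBruijn (m + 1) fun i => arcLabel (m + 1) (v i) (v (i + 1)) := by
  obtain ⟨q, hq⟩ := hv.exists_insertZero_mem
  have hlt := one_lt_two_pow_succ m
  -- The offset is chosen so that it brings the starting point `q` back to `0`.
  refine ⟨_, deBruijnWalks.isDeBruijn hq, _, deBruijnWalks.inLongestZeroRun hq,
    q * (2 ^ (m + 1) - 2), fun i => ?_⟩
  have hr := Nat.mod_lt (i + q * (2 ^ (m + 1) - 2)) (show 0 < 2 ^ (m + 1) - 1 by omega)
  have hmod : ∀ i, v (i % (2 ^ (m + 1) - 1)) = v i := fun i =>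
    Function.Periodic.map_mod_nat hv.periodic i
  set r := (i + q * (2 ^ (m + 1) - 2)) % (2 ^ (m + 1) - 1) with hrdef
  have hidx : 2 ^ (m + 1) - 1 + 1 + r + 1 = r + 1 + 2 ^ (m + 1) := by omega
  have hv' : v (q + 1 + r) = v (i + 1) := by
    have hsum : q + 1 + (i + q * (2 ^ (m + 1) - 2)) = i + 1 + q * (2 ^ (m + 1) - 1) := by
      rw [show 2 ^ (m + 1) - 1 = 2 ^ (m + 1) - 2 + 1 by omega]; ring
    rw [← hmod, hrdef, Nat.add_mod_mod, hsum, Nat.add_mul_mod_self_right, hmod]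
  change arcLabel (m + 1) (v i) (v (i + 1)) = _
  rw [arcLabel_eq_last (hv.adj i), hidx, hq.2.2.1, insertZero_succ v q hr, hv']

/-- The labels determine the words of labels, hence the vertices. -/
theorem ListsHamiltonianCycle.eq_add_of_arcLabel_eq {m : ℕ} {v v' : ℕ → Omega (m + 1)}
    (hv : ListsHamiltonianCycle v) (hv' : ListsHamiltonianCycle v') {k : ℕ}
    (h : ∀ i, arcLabel (m + 1) (v i) (v (i + 1)) =
      arcLabel (m + 1) (v' (i + k)) (v' (i + k + 1))) (i : ℕ) : v i = v' (i + k) := by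
  have hs : ∀ {v : ℕ → Omega (m + 1)}, ListsHamiltonianCycle v → ∀ t (j : Fin (m + 1)),
      vertexWord (v (t + (m + 1))) j =
        arcLabel (m + 1) (v (t + j)) (v (t + j + 1)) := fun {v} hv t j => by
    rw [arcLabel_eq_last (hv.adj _)]
    exact apply_add_eq_last_of_shift (y := fun t => vertexWord (v t))
      (fun t => (Gamma_adj_iff _ _).1 (hv.adj t)) t j
  have hlate : ∀ i, v (i + (m + 1)) = v' (i + k + (m + 1)) := fun i =>
    vertexWord_injective m <| funext fun j => by
      rw [hs hv, hs hv', h, add_right_comm]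
  -- Every place agrees with one that comes after at least `m + 1` steps.
  have hp : ∀ {v : ℕ → Omega (m + 1)}, ListsHamiltonianCycle v → ∀ i,
      v (i + (m + 1) * (2 ^ (m + 1) - 1)) = v i := fun hv i => by
    simpa using Function.Periodic.nat_mul hv.periodic (m + 1) i
  have hle : m + 1 ≤ (m + 1) * (2 ^ (m + 1) - 1) :=
    Nat.le_mul_of_pos_right _ (by have := one_lt_two_pow_succ m; omega)
  obtain ⟨c, hc⟩ := Nat.exists_eq_add_of_le' hle
  have := hlate (i + c)
  rw [add_right_comm i c k, add_assoc, add_assoc (i + k), ← hc, hp hv, hp hv'] at this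
  exact this

/-! ### Counting Hamiltonian cycles -/

/-- The vertices that a closed walk through all words visits between two visits to the zero word,
repeated periodically. The map `ψ` sends a nonzero word to the vertex with this word of labels. -/
def walkVertices {m : ℕ} (ψ : (Fin (m + 1) → ZMod 2) → Omega (m + 1))
    (y : ℕ → Fin (m + 1) → ZMod 2) (i : ℕ) : Omega (m + 1) :=
  ψ (y (i % (2 ^ (m + 1) - 1) + 1))

theorem deBruijnWalks.apply_ne_zero {m : ℕ} {y : ℕ → Fin (m + 1) → ZMod 2}
    (hy : y ∈ deBruijnWalks m) {t : ℕ} (h0 : 0 < t) (ht : t < 2 ^ (m + 1)) : y t ≠ 0 := fun h =>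
  h0.ne' (hy.2.2.2 ht (Nat.two_pow_pos (m + 1)) (h.trans hy.1.symm))

theorem vertexWord_walkVertices {m : ℕ} {ψ : (Fin (m + 1) → ZMod 2) → Omega (m + 1)}
    (hψ : ∀ w ≠ 0, vertexWord (ψ w) = w) {y : ℕ → Fin (m + 1) → ZMod 2}
    (hy : y ∈ deBruijnWalks m) (i : ℕ) :
    vertexWord (walkVertices ψ y i) = y (i % (2 ^ (m + 1) - 1) + 1) := by
  have hlt := one_lt_two_pow_succ m
  have h := Nat.mod_lt i (show 0 < 2 ^ (m + 1) - 1 by omega)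
  exact hψ _ (deBruijnWalks.apply_ne_zero hy (Nat.succ_pos _) (by omega))

theorem lists_walkVertices {m : ℕ} {ψ : (Fin (m + 1) → ZMod 2) → Omega (m + 1)}
    (hψ : ∀ w ≠ 0, vertexWord (ψ w) = w) {y : ℕ → Fin (m + 1) → ZMod 2}
    (hy : y ∈ deBruijnWalks m) : ListsHamiltonianCycle (walkVertices ψ y) := by
  have hlt := one_lt_two_pow_succ m
  refine ⟨fun i => by simp [walkVertices], fun i hi j hj hij => ?_, fun i => ?_⟩
  · have hi : i < 2 ^ (m + 1) - 1 := hi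
    have hj : j < 2 ^ (m + 1) - 1 := hj
    have h := congrArg vertexWord hij
    rw [vertexWord_walkVertices hψ hy, vertexWord_walkVertices hψ hy, Nat.mod_eq_of_lt hi,
      Nat.mod_eq_of_lt hj] at h
    exact Nat.succ_injective (hy.2.2.2 (Set.mem_Iio.2 (by omega)) (Set.mem_Iio.2 (by omega)) h)
  · rw [Gamma_adj_iff, vertexWord_walkVertices hψ hy, vertexWord_walkVertices hψ hy,
      ← Nat.mod_add_mod]
    have hr := Nat.mod_lt i (show 0 < 2 ^ (m + 1) - 1 by omega)
    set r := i % (2 ^ (m + 1) - 1)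
    rcases Nat.lt_or_ge (r + 1) (2 ^ (m + 1) - 1) with h | h
    · rw [Nat.mod_eq_of_lt h]
      exact hy.2.1 _
    · -- The walk passes from the last vertex to the first one through the zero word.
      have h1 : r + 1 = 2 ^ (m + 1) - 1 := by omega
      have h2 : y (2 ^ (m + 1) - 1 + 1) = 0 := by
        rw [Nat.sub_add_cancel hlt.le, ← hy.1, ← hy.2.2.1 0, zero_add]
      rw [h1, Nat.mod_self, hy.2.1, ← hy.2.1 (2 ^ (m + 1) - 1), h2, hy.1]
      rfl

/-- After the zero word there is only one way to go on. -/
theorem deBruijnWalks.apply_one {m : ℕ} {y : ℕ → Fin (m + 1) → ZMod 2}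
    (hy : y ∈ deBruijnWalks m) : y 1 = Fin.snoc 0 1 := by
  have h1 : Fin.init (y 1) = 0 := by
    have := hy.2.1 0
    rw [hy.1] at this
    exact this
  have hb : ∀ b : ZMod 2, b = 0 ∨ b = 1 := by decide
  have hs := (Fin.snoc_init_self (y 1)).symm
  rw [h1] at hs
  rcases hb (y 1 (Fin.last m)) with h | h
  · refine absurd ?_ (deBruijnWalks.apply_ne_zero hy one_pos (one_lt_two_pow_succ m))
    rw [hs, h]
    funext j
    induction j using Fin.lastCases <;> simp
  · rwa [h] at hs

theorem ncard_isHamiltonianCycle (m : ℕ) :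
    {H : Cycle (Omega (m + 1)) | IsHamiltonianCycle (Gamma (m + 1)) H}.ncard =
      2 ^ (2 ^ m - (m + 1)) := by
  have hlt := one_lt_two_pow_succ m
  obtain ⟨ψ, hψ⟩ : ∃ ψ : (Fin (m + 1) → ZMod 2) → Omega (m + 1),
      ∀ w ≠ 0, vertexWord (ψ w) = w := by
    have hne : Nonempty (Omega (m + 1)) := by
      refine (Nat.card_ne_zero.1 ?_).1
      rw [natCard_Omega]
      omega
    exact ⟨Function.invFun vertexWord, fun w hw =>
      Function.invFun_eq (exists_vertexWord_eq hw)⟩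
  let F : (ℕ → Fin (m + 1) → ZMod 2) → Cycle (Omega (m + 1)) := fun y =>
    (((List.range (2 ^ (m + 1) - 1)).map (walkVertices ψ y) : List (Omega (m + 1))) : Cycle _)
  have himg : {H : Cycle (Omega (m + 1)) | IsHamiltonianCycle (Gamma (m + 1)) H} =
      F '' deBruijnWalks m := by
    ext H
    constructor
    · intro hH
      have hH : IsHamiltonianCycle (Gamma (m + 1)) H := hH
      have hlen := hH.length_eq
      obtain ⟨v, hHv, hper⟩ := H.exists_eq_map_range (by omega)
      have hv := hH.lists hHv hper
      obtain ⟨q, hq⟩ := hv.exists_insertZero_mem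
      refine ⟨_, hq, ?_⟩
      rw [hHv, hlen, Cycle.coe_eq_coe]
      refine List.IsRotated.symm ⟨q + 1, ?_⟩
      rw [List.rotate_map_range_of_periodic hv.periodic]
      refine List.map_congr_left fun i hi => vertexWord_injective m ?_
      have hi := List.mem_range.1 hi
      rw [vertexWord_walkVertices hψ hq, Nat.mod_eq_of_lt hi, insertZero_succ v q hi,
        add_comm i]
    · rintro ⟨y, hy, rfl⟩
      exact (lists_walkVertices hψ hy).isHamiltonianCycle
  rw [himg, ← ncard_deBruijnWalks m]
  refine Set.InjOn.ncard_image fun y hy y' hy' h => ?_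
  have hl := lists_walkVertices hψ hy
  obtain ⟨k, hk⟩ := Cycle.coe_eq_coe.1 h
  rw [List.rotate_map_range_of_periodic hl.periodic] at hk
  have hk : ∀ i < 2 ^ (m + 1) - 1, walkVertices ψ y (i + k) = walkVertices ψ y' i :=
    fun i hi => List.map_inj_left.1 hk i (List.mem_range.2 hi)
  -- Both lists start with the vertex after the zero word, so that the rotation is trivial.
  have hk0 : 0 + k ≡ 0 [MOD 2 ^ (m + 1) - 1] := by
    rw [← periodic_apply_eq_iff_modEq (by omega) hl.periodic hl.injOn,
      hk 0 (by omega)]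
    simp [walkVertices, deBruijnWalks.apply_one hy, deBruijnWalks.apply_one hy']
  have hvert : ∀ i < 2 ^ (m + 1) - 1, y (i + 1) = y' (i + 1) := by
    intro i hi
    have h1 := hk i hi
    rw [(periodic_apply_eq_iff_modEq (by omega) hl.periodic hl.injOn (i + k) i).2
      (by simpa using hk0.add_left i)] at h1
    have h2 := congrArg vertexWord h1
    rwa [vertexWord_walkVertices hψ hy, vertexWord_walkVertices hψ hy',
      Nat.mod_eq_of_lt hi] at h2
  funext t
  rw [← Function.Periodic.map_mod_nat hy.2.2.1 t, ← Function.Periodic.map_mod_nat hy'.2.2.1 t]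
  have ht := Nat.mod_lt t (Nat.two_pow_pos (m + 1))
  rcases Nat.eq_zero_or_eq_succ_pred (t % 2 ^ (m + 1)) with h0 | h0
  · rw [h0, hy.1, hy'.1]
  · rw [h0]
    exact hvert _ (by omega)

theorem mainTheorem3 (n : ℕ) (hn : 4 ≤ n) :
    (∀ H : Cycle (Omega n), IsHamiltonianCycle (Gamma n) H →
      (∃ s : ℕ → ZMod 2, CorrespondsTo H s) ∧
      ∀ s : ℕ → ZMod 2, CorrespondsTo H s → IsModifiedDeBruijn n s) ∧
    (∀ H H' : Cycle (Omega n), IsHamiltonianCycle (Gamma n) H → IsHamiltonianCycle (Gamma n) H' →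
      H ≠ H' → ∀ s s' : ℕ → ZMod 2, CorrespondsTo H s → CorrespondsTo H' s' →
        ¬ CyclicallyEquivalent s s') ∧
    {H : Cycle (Omega n) | IsHamiltonianCycle (Gamma n) H}.ncard = 2 ^ (2 ^ (n - 1) - n) := by
  obtain ⟨m, rfl⟩ := Nat.exists_eq_succ_of_ne_zero (by omega : n ≠ 0)
  refine ⟨fun H hH => ⟨?_, ?_⟩, ?_, ncard_isHamiltonianCycle m⟩
  · have hlt := one_lt_two_pow_succ m
    have hlen := hH.length_eq
    obtain ⟨v, hHv, hv⟩ := H.exists_eq_map_range (by omega)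
    exact ⟨_, v, hHv, hv, fun _ => rfl⟩
  · rintro s ⟨v, hHv, hv, hs⟩
    rw [funext hs]
    exact (hH.lists hHv hv).isModifiedDeBruijn
  · rintro H H' hH hH' hne s s' ⟨v, hHv, hv, hs⟩ ⟨v', hHv', hv', hs'⟩ ⟨k, hk⟩
    have hl := hH.lists hHv hv
    have hl' := hH'.lists hHv' hv'
    have heq := hl.eq_add_of_arcLabel_eq hl' (k := k) fun i => by rw [← hs, ← hs', hk]
    refine hne ?_
    rw [hHv, hHv', hH.length_eq, hH'.length_eq, funext heq, Cycle.coe_eq_coe]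
    exact List.IsRotated.symm ⟨k, List.rotate_map_range_of_periodic hl'.periodic k⟩
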